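/- Let $A(\rho)=A_0+\sum_{i=1}^{p}\rho_iA_i$ with $A_0,\dots,A_p\in\mathbb{R}^{n\times n}$ and $\rho\in\mathbb{R}^p$, and let $B\in\mathbb{R}^{n\times m}$. For $\rho\in\mathbb{R}^p$ let $$\mathcal{K}_\rho=\{K\in\mathbb{R}^{m\times n} : \operatorname{Re}\lambda<0 \text{ for every complex eigenvalue } \lambda \text{ of } A(\rho)-BK\}$$ be the stability region of $(A(\rho),B)$. Write $$\det\bigl(sI-(A(\rho)-BK)\bigr)=s^n+c_1s^{n-1}+\dots+c_{n-1}s+c_n,\qquad c_0=1,\quad c_k=0 \text{ for } k>n,$$ and define the division-free modified Routh table by $\tilde R_{1,j}=c_{2j-2}$, $\tilde R_{2,j}=c_{2j-1}$ and $$\tilde R_{i,j}=\tilde R_{i-1,1}\tilde R_{i-2,j+1}-\tilde R_{i-2,1}\tilde R_{i-1,j+1}\qquad (3\le i\le n,\ j\ge 1).$$ Put $f_i(K,\rho)=\tilde R_{i+1,1}$ for $1\le i<n$ (so that $f_1=c_1$) and $f_n(K,\rho)=c_n$. Then $f_1,\dots,f_n$ are polynomials with real coefficients in the entries of $K$ and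 $\rho$ (the same polynomials for all $K$ and $\rho$), and for every $\rho\in\mathbb{R}^p$, in particular for every $\rho$ in a given parameter set $\mathcal{P}\subset\mathbb{R}^p$, $$\mathcal{K}_\rho=\{K\in\mathbb{R}^{m\times n} : f_i(K,\rho)>0,\ i=1,\dots,n\}.$$ -/

import Mathlib

/-- The affine parameter-dependent system matrix `A(ρ) = A₀ + ∑ i, ρ i • A i`. -/
def lpvMatrix {n p : ℕ} (A₀ : Matrix (Fin n) (Fin n) ℝ) (A : Fin p → Matrix (Fin n) (Fin n) ℝ)
    (ρ : Fin p → ℝ) : Matrix (Fin n) (Fin n) ℝ :=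
  A₀ + ∑ i, ρ i • A i

/-- A real square matrix is Hurwitz if all its complex eigenvalues have negative real part. -/
def IsHurwitz {n : ℕ} (M : Matrix (Fin n) (Fin n) ℝ) : Prop :=
  ∀ z ∈ spectrum ℂ (M.map (fun x : ℝ => (x : ℂ))), z.re < 0

/-- The set of gains `K` for which `M - B K` is Hurwitz (for `M = A(ρ)`, the set `𝒦_ρ`). -/
def stabilityRegion {n m : ℕ} (M : Matrix (Fin n) (Fin n) ℝ) (B : Matrix (Fin n) (Fin m) ℝ) :
    Set (Matrix (Fin m) (Fin n) ℝ) :=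
  {K | IsHurwitz (M - B * K)}

/-- The coefficient `c_k` of `q(s) = c_0 s^n + c_1 s^(n-1) + ⋯ + c_n`; missing terms
(`k > n`) are zero. -/
def routhCoeff {R : Type*} [CommRing R] (n : ℕ) (q : Polynomial R) (k : ℕ) : R :=
  if k ≤ n then q.coeff (n - k) else 0

/-- The division-free modified Routh table. Rows and columns are counted from `0`: the entry in
row `i` and column `j` here is the entry with indices `i + 1`, `j + 1` in the usual 1-based
numbering. The first two rows are `c_0, c_2, c_4, …` and `c_1, c_3, c_5, …`. -/
def modRouth {R : Type*} [CommRing R] (c : ℕ → R) : ℕ → ℕ → R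
  | 0, j => c (2 * j)
  | 1, j => c (2 * j + 1)
  | i + 2, j =>
      modRouth c (i + 1) 0 * modRouth c i (j + 1) - modRouth c i 0 * modRouth c (i + 1) (j + 1)

/-- The `n` test quantities for a polynomial of degree `n`. For `1 ≤ i < n` the `i`-th one is the
first entry of the (1-based) row `i + 1` of the modified table (so it is `c_1` for `i = 1`), and
the `n`-th one is `c_n`. Here `i : Fin n` stands for the 1-based index `i + 1`. -/
def routhTest {R : Type*} [CommRing R] (n : ℕ) (q : Polynomial R) (i : Fin n) : R :=
  if (i : ℕ) + 1 = n then routhCoeff n q n else modRouth (routhCoeff n q) ((i : ℕ) + 1) 0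

/-- The value at `(K, ρ)` of a polynomial in the entries of `K` and of `ρ`. -/
noncomputable def evalGain {n m p : ℕ} (K : Matrix (Fin m) (Fin n) ℝ) (ρ : Fin p → ℝ)
    (f : MvPolynomial ((Fin m × Fin n) ⊕ Fin p) ℝ) : ℝ :=
  MvPolynomial.eval (Sum.elim (fun ij => K ij.1 ij.2) ρ) f

open Polynomial ComplexConjugate

/-! Split a real polynomial as P = E + O by parity of the coefficient index. One Routh step replaces
(E, O) by (O, c₁E - c₀sO), lowering the degree by one and shifting the table by one row. For c₀, c₁
> 0 this step preserves stability in both directions (`isStableSeq_routhReduce_iff`), and stability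
forces c₁ > 0, so induction on the degree gives the criterion. Both directions compare P with E - O,
whose zeros are the -conj r: on Re s ≥ 0 the quotient (E - O)/P is a Blaschke product. Its bound by
1 gives Re(E conj O) ≥ 0, and Julia's inequality sharpens this to c₀ Re s |O|² ≤ c₁ Re(E conj O). No
continuity or root-counting argument is needed. The table uses only ring operations, so it commutes
with evaluation; running it over a polynomial ring yields the `f i`. -/

/-- The part of `c_0 s^d + c_1 s^(d-1) + ⋯ + c_d` made of the coefficients of even index. -/
noncomputable def evenPart (d : ℕ) (c : ℕ → ℝ) (s : ℂ) : ℂ :=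
  ∑ k ∈ Finset.range (d + 1), if Even k then (c k : ℂ) * s ^ (d - k) else 0

/-- The part of `c_0 s^d + c_1 s^(d-1) + ⋯ + c_d` made of the coefficients of odd index. -/
noncomputable def oddPart (d : ℕ) (c : ℕ → ℝ) (s : ℂ) : ℂ :=
  ∑ k ∈ Finset.range (d + 1), if Even k then 0 else (c k : ℂ) * s ^ (d - k)

/-- The polynomial `c_0 s^d + c_1 s^(d-1) + ⋯ + c_d` has no zero in the closed right half-plane. -/
def IsStableSeq (d : ℕ) (c : ℕ → ℝ) : Prop :=
  ∀ s : ℂ, 0 ≤ s.re → evenPart d c s + oddPart d c s ≠ 0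

/-- The coefficients of the polynomial of degree one less produced by one step of the
division-free Routh algorithm. -/
def routhReduce (c : ℕ → ℝ) (k : ℕ) : ℝ :=
  if Even k then c (k + 1) else c 1 * c (k + 1) - c 0 * c (k + 2)

/-! ### One Routh step on even and odd parts -/

theorem modRouth_routhReduce (c : ℕ → ℝ) (i j : ℕ) :
    modRouth (routhReduce c) i j = modRouth c (i + 1) j := by
  induction i using Nat.twoStepInduction generalizing j with
  | zero => simp [modRouth, routhReduce]
  | one =>
    have h : ¬ Even (2 * j + 1) := by simp
    simp only [modRouth, routhReduce, if_neg h]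
    ring_nf
  | more i h0 h1 =>
    rw [modRouth, h0, h0, h1, h1]
    rfl

theorem evenPart_add_oddPart (d : ℕ) (c : ℕ → ℝ) (s : ℂ) :
    evenPart d c s + oddPart d c s = ∑ k ∈ Finset.range (d + 1), (c k : ℂ) * s ^ (d - k) := by
  rw [evenPart, oddPart, ← Finset.sum_add_distrib]
  refine Finset.sum_congr rfl fun k _ => ?_
  split_ifs <;> simp

/-- The coefficients are real, so s ↦ -conj s followed by conjugation only changes signs according
to the parity of the exponent. -/
theorem conj_reflect_evenPart_add_oddPart (d : ℕ) (c : ℕ → ℝ) (s : ℂ) :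
    (-1) ^ d * conj (evenPart d c (-conj s) + oddPart d c (-conj s)) =
      evenPart d c s - oddPart d c s := by
  rw [evenPart_add_oddPart, evenPart, oddPart, ← Finset.sum_sub_distrib, map_sum, Finset.mul_sum]
  refine Finset.sum_congr rfl fun k hk => ?_
  obtain ⟨l, rfl⟩ := Nat.exists_eq_add_of_le (Nat.lt_succ_iff.1 (Finset.mem_range.1 hk))
  have h : ((-1 : ℂ) ^ l) * (-1) ^ l = 1 := by rw [← mul_pow]; simp
  simp only [map_mul, map_pow, map_neg, Complex.conj_conj, Complex.conj_ofReal,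
    Nat.add_sub_cancel_left]
  rw [neg_pow s l, pow_add]
  split_ifs with hk
  · rw [hk.neg_one_pow]
    linear_combination (c k : ℂ) * s ^ l * h
  · rw [(Nat.not_even_iff_odd.1 hk).neg_one_pow]
    linear_combination -(c k : ℂ) * s ^ l * h

theorem oddPart_succ (e : ℕ) (c : ℕ → ℝ) (s : ℂ) :
    oddPart (e + 1) c s = evenPart e (routhReduce c) s := by
  rw [oddPart, evenPart, Finset.sum_range_succ']
  simp only [Even.zero, if_true, add_zero]
  refine Finset.sum_congr rfl fun k _ => ?_
  by_cases hk : Even k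
  · simp [routhReduce, Nat.even_add_one, hk]
  · simp [Nat.even_add_one, hk]

theorem oddPart_routhReduce (e : ℕ) (c : ℕ → ℝ) (hc : c (e + 2) = 0) (s : ℂ) :
    oddPart e (routhReduce c) s =
      c 1 * evenPart (e + 1) c s - c 0 * s * oddPart (e + 1) c s := by
  have hE : evenPart (e + 1) c s = c 0 * s ^ (e + 1) +
      ∑ k ∈ Finset.range (e + 1), if Even k then 0 else (c (k + 1) : ℂ) * s ^ (e - k) := by
    rw [evenPart, Finset.sum_range_succ', add_comm]
    simp [Nat.even_add_one, -Nat.not_even_iff_odd]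
  have hO : s * oddPart (e + 1) c s = c 1 * s ^ (e + 1) +
      ∑ k ∈ Finset.range (e + 1), if Even k then 0 else (c (k + 2) : ℂ) * s ^ (e - k) := by
    rw [oddPart, Finset.sum_range_succ', Finset.sum_range_succ', Finset.sum_range_succ,
      mul_add, mul_add, Finset.mul_sum]
    have : ∀ k ∈ Finset.range e, s * (if Even (k + 1 + 1) then (0 : ℂ) else
        (c (k + 1 + 1) : ℂ) * s ^ (e + 1 - (k + 1 + 1))) =
        if Even k then 0 else (c (k + 2) : ℂ) * s ^ (e - k) := by
      intro k hk
      obtain ⟨l, rfl⟩ := Nat.exists_eq_add_of_lt (Finset.mem_range.1 hk)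
      have h1 : k + l + 1 + 1 - (k + 1 + 1) = l := by omega
      have h2 : k + l + 1 - k = l + 1 := by omega
      rw [h1, h2]
      by_cases h : Even k
      · simp [h]
      · simp only [Nat.even_add_one, not_not, h, if_false]
        ring
    rw [Finset.sum_congr rfl this]
    -- The term k = e would be a constant term, absent from s * O; `hc` makes it vanish.
    simp [hc]
    ring
  rw [mul_assoc, hO, hE, oddPart, mul_add, mul_add, Finset.mul_sum, Finset.mul_sum]
  rw [show ∀ a b x y : ℂ, a * (b * s ^ (e + 1)) + x - (b * (a * s ^ (e + 1)) + y) = x - y by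
    intros; ring, ← Finset.sum_sub_distrib]
  refine Finset.sum_congr rfl fun k _ => ?_
  split_ifs with h
  · simp
  · simp only [routhReduce, if_neg h]
    push_cast
    ring

/-! ### Julia's inequality and its consequences for E and O -/

/-- Adding one Blaschke factor needs this Cauchy–Schwarz step: the product of the two bounds and
AM-GM control the cross term. -/
theorem mul_norm_add_sq_le {x S t A B : ℝ} {X Y : ℂ} (hx : 0 ≤ x) (hS : 0 ≤ S) (ht : 0 ≤ t)
    (hA : 0 ≤ A) (hB : 0 ≤ B) (hX : x * ‖X‖ ^ 2 ≤ S * A) (hY : x * ‖Y‖ ^ 2 ≤ t * B) :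
    x * ‖X + Y‖ ^ 2 ≤ (S + t) * (A + B) := by
  have hcross : 2 * (x * (‖X‖ * ‖Y‖)) ≤ S * B + t * A := by
    refine abs_le_of_sq_le_sq' ?_ (by positivity) |>.2
    have h := mul_le_mul hX hY (by positivity) (by positivity)
    nlinarith [sq_nonneg (S * B - t * A)]
  have htri : x * ‖X + Y‖ ^ 2 ≤ x * (‖X‖ + ‖Y‖) ^ 2 := by
    gcongr
    exact norm_add_le X Y
  nlinarith

/-- Julia's inequality at infinity for finite Blaschke products of the right half-plane, in
division-free form. -/
theorem julia_multiset (s : ℂ) (hs : 0 ≤ s.re) (m : Multiset ℂ) (hm : ∀ r ∈ m, r.re < 0) :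
    0 ≤ (m.map fun r => -r.re).sum ∧
    ‖(m.map fun r => s + conj r).prod‖ ^ 2 ≤ ‖(m.map fun r => s - r).prod‖ ^ 2 ∧
    s.re * ‖(m.map fun r => s - r).prod - (m.map fun r => s + conj r).prod‖ ^ 2 ≤
      (m.map fun r => -r.re).sum *
        (‖(m.map fun r => s - r).prod‖ ^ 2 - ‖(m.map fun r => s + conj r).prod‖ ^ 2) := by
  induction m using Multiset.induction_on with
  | empty => simp
  | cons r m ih =>
    obtain ⟨hS, hle, hJ⟩ := ih fun q hq => hm q (Multiset.mem_cons_of_mem hq)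
    have hr : r.re < 0 := hm r (Multiset.mem_cons_self r m)
    simp only [Multiset.map_cons, Multiset.prod_cons, Multiset.sum_cons]
    set u := (m.map fun r => s - r).prod
    set w := (m.map fun r => s + conj r).prod
    set S := (m.map fun r => -r.re).sum
    have hdiff : ‖s - r‖ ^ 2 - ‖s + conj r‖ ^ 2 = -4 * r.re * s.re := by
      rw [Complex.sq_norm, Complex.sq_norm, Complex.normSq_apply, Complex.normSq_apply]
      simp
      ring
    have hab : ‖(s - r) - (s + conj r)‖ ^ 2 = 4 * r.re ^ 2 := by
      rw [Complex.sq_norm, Complex.normSq_apply]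
      simp
      ring
    have hd0 : 0 ≤ ‖s - r‖ ^ 2 - ‖s + conj r‖ ^ 2 := by rw [hdiff]; nlinarith
    have hA : 0 ≤ ‖s - r‖ ^ 2 * (‖u‖ ^ 2 - ‖w‖ ^ 2) :=
      mul_nonneg (sq_nonneg _) (sub_nonneg.2 hle)
    have hB : 0 ≤ ‖w‖ ^ 2 * (‖s - r‖ ^ 2 - ‖s + conj r‖ ^ 2) := mul_nonneg (sq_nonneg _) hd0
    have hsum : ‖(s - r) * u‖ ^ 2 - ‖(s + conj r) * w‖ ^ 2 =
        ‖s - r‖ ^ 2 * (‖u‖ ^ 2 - ‖w‖ ^ 2) + ‖w‖ ^ 2 * (‖s - r‖ ^ 2 - ‖s + conj r‖ ^ 2) := by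
      rw [norm_mul, norm_mul]
      ring
    refine ⟨by linarith, by linarith, ?_⟩
    -- Both the difference and the defect of squared norms split into an old part and a part from
    -- the new factor.
    rw [hsum, add_comm (-r.re) S, show (s - r) * u - (s + conj r) * w =
      (s - r) * (u - w) + w * ((s - r) - (s + conj r)) by ring]
    refine mul_norm_add_sq_le hs hS (by linarith) hA hB ?_ ?_
    · rw [norm_mul, mul_pow]
      nlinarith [mul_le_mul_of_nonneg_left hJ (sq_nonneg ‖s - r‖)]
    · rw [norm_mul, mul_pow, hab, hdiff]
      exact le_of_eq (by ring)

/-- The complex roots of `c_0 s^d + c_1 s^(d-1) + ⋯ + c_d`. -/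
theorem exists_roots (d : ℕ) (c : ℕ → ℝ) (h0 : c 0 ≠ 0) :
    ∃ m : Multiset ℂ, Multiset.card m = d ∧
      (∀ s, evenPart d c s + oddPart d c s = c 0 * (m.map fun r => s - r).prod) ∧
      (1 ≤ d → (c 1 : ℂ) = -(c 0 * m.sum)) := by
  set P : ℂ[X] := ∑ j ∈ Finset.range (d + 1), C (c (d - j) : ℂ) * X ^ j with hP
  have hcoeff : ∀ j, P.coeff j = if j ≤ d then (c (d - j) : ℂ) else 0 := by
    intro j
    simp [hP, coeff_C_mul, coeff_X_pow]
  have hc0 : (c 0 : ℂ) ≠ 0 := by exact_mod_cast h0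
  have hdeg : P.natDegree = d := by
    refine natDegree_eq_of_le_of_coeff_ne_zero ?_ ?_
    · refine natDegree_le_iff_coeff_eq_zero.2 fun N hN => ?_
      rw [hcoeff, if_neg (by omega)]
    · simpa [hcoeff] using h0
  have hlead : P.leadingCoeff = c 0 := by simp [leadingCoeff, hdeg, hcoeff]
  have hsplit : P.Splits := IsAlgClosed.splits P
  have heval : ∀ s, P.eval s = evenPart d c s + oddPart d c s := by
    intro s
    rw [evenPart_add_oddPart, ← Finset.sum_range_reflect, hP, eval_finsetSum]
    refine Finset.sum_congr rfl fun j hj => ?_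
    have hj' : j ≤ d := Nat.lt_succ_iff.1 (Finset.mem_range.1 hj)
    rw [show d + 1 - 1 - j = d - j by omega, show d - (d - j) = j by omega]
    simp
  refine ⟨P.roots, ?_, fun s => ?_, fun hd => ?_⟩
  · rw [← hdeg, hsplit.natDegree_eq_card_roots]
  · rw [← heval, hsplit.eval_eq_prod_roots, hlead]
  · have h := hsplit.nextCoeff_eq_neg_sum_roots_mul_leadingCoeff
    rw [nextCoeff_of_natDegree_pos (by omega), hdeg, hcoeff, if_pos (by omega), hlead,
      show d - (d - 1) = 1 by omega] at h
    rw [h]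
    ring

theorem IsStableSeq.exists_roots {d : ℕ} {c : ℕ → ℝ} (h : IsStableSeq d c) (h0 : 0 < c 0) :
    ∃ m : Multiset ℂ, Multiset.card m = d ∧ (∀ r ∈ m, r.re < 0) ∧
      (∀ s, evenPart d c s + oddPart d c s = c 0 * (m.map fun r => s - r).prod) ∧
      (∀ s, evenPart d c s - oddPart d c s = c 0 * (m.map fun r => s + conj r).prod) ∧
      (1 ≤ d → c 1 = c 0 * (m.map fun r => -r.re).sum) := by
  obtain ⟨m, hcard, hprod, hsum⟩ := _root_.exists_roots d c h0.ne'
  refine ⟨m, hcard, fun r hr => ?_, hprod, fun s => ?_, fun hd => ?_⟩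
  · by_contra! hre
    refine h r hre ?_
    rw [hprod, Multiset.prod_eq_zero (Multiset.mem_map.2 ⟨r, hr, sub_self r⟩), mul_zero]
  · rw [← conj_reflect_evenPart_add_oddPart, hprod, map_mul, Complex.conj_ofReal,
      map_multiset_prod, Multiset.map_map, ← hcard, mul_left_comm]
    congr 1
    -- The sign (-1)^d is distributed over the d factors, turning each into s + conj r.
    rw [← Multiset.card_map (fun r => conj (-conj s - r)) m]
    rw [show ((starRingEnd ℂ) ∘ fun r => -conj s - r) = fun r => conj (-conj s - r) from rfl,
      ← Multiset.prod_map_neg, Multiset.map_map]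
    congr 2
    funext r
    simp
    ring
  · have h1 := congrArg Complex.re (hsum hd)
    rw [Complex.ofReal_re, Complex.neg_re, Complex.re_ofReal_mul] at h1
    have hre : m.sum.re = (m.map Complex.re).sum := map_multiset_sum Complex.reAddGroupHom m
    rw [h1, Multiset.sum_map_neg, hre, mul_neg]

theorem IsStableSeq.coeff_one_pos {d : ℕ} {c : ℕ → ℝ} (h : IsStableSeq (d + 1) c)
    (h0 : 0 < c 0) : 0 < c 1 := by
  obtain ⟨m, hcard, hm, -, -, hsum⟩ := h.exists_roots h0
  rw [hsum (by omega)]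
  refine mul_pos h0 ?_
  obtain ⟨r, hr⟩ := Multiset.card_pos_iff_exists_mem.1 (by omega : 0 < Multiset.card m)
  obtain ⟨t, rfl⟩ := Multiset.exists_cons_of_mem hr
  rw [Multiset.map_cons, Multiset.sum_cons]
  have h1 := hm r hr
  have h2 : 0 ≤ (t.map fun r => -r.re).sum := by
    refine Multiset.sum_nonneg fun x hx => ?_
    obtain ⟨q, hq, rfl⟩ := Multiset.mem_map.1 hx
    linarith [hm q (Multiset.mem_cons_of_mem hq)]
  linarith

theorem norm_add_sq_sub_norm_sub_sq (a b : ℂ) :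
    ‖a + b‖ ^ 2 - ‖a - b‖ ^ 2 = 4 * (a * conj b).re := by
  rw [Complex.sq_norm, Complex.sq_norm, Complex.normSq_apply, Complex.normSq_apply]
  simp
  ring

theorem IsStableSeq.re_mul_conj_nonneg {d : ℕ} {c : ℕ → ℝ} (h : IsStableSeq d c)
    (h0 : 0 < c 0) {s : ℂ} (hs : 0 ≤ s.re) :
    0 ≤ (evenPart d c s * conj (oddPart d c s)).re := by
  obtain ⟨m, -, hm, hu, hw, -⟩ := h.exists_roots h0
  have hle := (julia_multiset s hs m hm).2.1
  have h4 := norm_add_sq_sub_norm_sub_sq (evenPart d c s) (oddPart d c s)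
  rw [hu, hw, norm_mul, norm_mul, mul_pow, mul_pow, ← mul_sub] at h4
  nlinarith [mul_nonneg (sq_nonneg ‖(c 0 : ℂ)‖) (sub_nonneg.2 hle)]

theorem IsStableSeq.julia {d : ℕ} {c : ℕ → ℝ} (h : IsStableSeq (d + 1) c)
    (h0 : 0 < c 0) {s : ℂ} (hs : 0 ≤ s.re) :
    c 0 * s.re * ‖oddPart (d + 1) c s‖ ^ 2 ≤
      c 1 * (evenPart (d + 1) c s * conj (oddPart (d + 1) c s)).re := by
  obtain ⟨m, -, hm, hu, hw, hsum⟩ := h.exists_roots h0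
  have hJ := (julia_multiset s hs m hm).2.2
  have h4 := norm_add_sq_sub_norm_sub_sq (evenPart (d + 1) c s) (oddPart (d + 1) c s)
  have h2 : 2 * oddPart (d + 1) c s = c 0 * ((m.map fun r => s - r).prod -
      (m.map fun r => s + conj r).prod) := by
    rw [mul_sub, ← hu, ← hw]
    ring
  have h2' := congrArg (fun z : ℂ => ‖z‖ ^ 2) h2
  have hn : ‖(c 0 : ℂ)‖ = c 0 := by rw [Complex.norm_real, Real.norm_of_nonneg h0.le]
  simp only [norm_mul, mul_pow, Complex.norm_ofNat, hn] at h2'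
  rw [hu, hw, norm_mul, norm_mul, mul_pow, mul_pow, ← mul_sub, hn] at h4
  rw [hsum (by omega)]
  -- Two factors c₀ come from the squared norms, the third from c₁ = c₀ ∑ (-Re r).
  have hJ3 := mul_le_mul_of_nonneg_left hJ (pow_nonneg h0.le 3)
  linear_combination (1 / 4) * hJ3 + (1 / 4) * c 0 * s.re * h2' +
    (1 / 4) * c 0 * (m.map fun r => -r.re).sum * h4

/-! ### The Routh criterion -/

theorem isStableSeq_routhReduce_iff {e : ℕ} {c : ℕ → ℝ} (h0 : 0 < c 0) (h1 : 0 < c 1)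
    (hc : c (e + 2) = 0) : IsStableSeq e (routhReduce c) ↔ IsStableSeq (e + 1) c := by
  have hc1 : (c 1 : ℂ) ≠ 0 := by exact_mod_cast h1.ne'
  constructor
  · intro h s hs hz
    have hnn := h.re_mul_conj_nonneg (by simpa [routhReduce] using h1) hs
    refine h s hs ?_
    rw [oddPart_routhReduce e c hc, ← oddPart_succ] at hnn ⊢
    have hE : evenPart (e + 1) c s = -oddPart (e + 1) c s := eq_neg_of_add_eq_zero_left hz
    -- At a zero of P, E = -O makes the nonnegative quantity a negative multiple of |O|².
    rw [hE] at hnn ⊢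
    have hcomp : (oddPart (e + 1) c s * conj (c 1 * -oddPart (e + 1) c s -
        c 0 * s * oddPart (e + 1) c s)).re =
        -(c 1 + c 0 * s.re) * ‖oddPart (e + 1) c s‖ ^ 2 := by
      rw [Complex.sq_norm, Complex.normSq_apply]
      simp
      ring
    rw [hcomp] at hnn
    have hpos : 0 < c 1 + c 0 * s.re := by positivity
    have hO : oddPart (e + 1) c s = 0 := by
      by_contra hne
      have : 0 < ‖oddPart (e + 1) c s‖ ^ 2 := by positivity
      nlinarith
    simp [hO]
  · intro h s hs hz
    rw [oddPart_routhReduce e c hc, ← oddPart_succ] at hz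
    have hJ := h.julia h0 hs
    have hre := congrArg (fun z : ℂ => (z * conj (oddPart (e + 1) c s)).re) hz
    have hcomp : ((oddPart (e + 1) c s + (c 1 * evenPart (e + 1) c s -
        c 0 * s * oddPart (e + 1) c s)) * conj (oddPart (e + 1) c s)).re =
        ‖oddPart (e + 1) c s‖ ^ 2 +
          (c 1 * (evenPart (e + 1) c s * conj (oddPart (e + 1) c s)).re -
            c 0 * s.re * ‖oddPart (e + 1) c s‖ ^ 2) := by
      rw [Complex.sq_norm, Complex.normSq_apply]
      simp
      ring
    simp only [hcomp, zero_mul, Complex.zero_re] at hre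
    have hO : oddPart (e + 1) c s = 0 := by
      by_contra hne
      have : 0 < ‖oddPart (e + 1) c s‖ ^ 2 := by positivity
      linarith
    rw [hO] at hz
    refine h s hs ?_
    simpa [hO, hc1] using hz

/-- The Routh criterion in its division-free form. -/
theorem isStableSeq_iff_modRouth_pos (d : ℕ) (c : ℕ → ℝ) (h0 : 0 < c 0)
    (hc : ∀ k, d < k → c k = 0) :
    IsStableSeq d c ↔ (∀ i, 1 ≤ i → i < d → 0 < modRouth c i 0) ∧ 0 < c d := by
  induction d generalizing c with
  | zero =>
    refine ⟨fun _ => ⟨fun i _ hi => absurd hi (Nat.not_lt_zero i), h0⟩, fun _ s _ => ?_⟩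
    simpa [evenPart, oddPart] using h0.ne'
  | succ e ih =>
    have key : 0 < c 1 → (IsStableSeq (e + 1) c ↔
        (∀ i, 1 ≤ i → i < e → 0 < modRouth c (i + 1) 0) ∧ 0 < c (e + 1)) := by
      intro h1
      rw [← isStableSeq_routhReduce_iff h0 h1 (hc _ (by omega)), ih]
      · refine and_congr (by simp only [modRouth_routhReduce]) ?_
        -- The last coefficient changes at most by the positive factor c₁, depending on parity.
        rw [routhReduce]
        split_ifs
        · rfl
        · rw [hc (e + 2) (by omega), mul_zero, sub_zero]
          exact mul_pos_iff_of_pos_left h1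
      · simpa [routhReduce] using h1
      · intro k hk
        simp [routhReduce, hc (k + 1) (by omega), hc (k + 2) (by omega)]
    constructor
    · intro h
      have h1 := h.coeff_one_pos h0
      obtain ⟨hi, hlast⟩ := (key h1).1 h
      refine ⟨fun i hi1 hie => ?_, hlast⟩
      obtain rfl | hi2 := hi1.eq_or_lt
      · simpa [modRouth] using h1
      · obtain ⟨j, rfl⟩ := Nat.exists_eq_add_of_le' hi1
        exact hi j (by omega) (by omega)
    · rintro ⟨hi, hlast⟩
      have h1 : 0 < c 1 := by
        -- In degree one no table row is tested, and c₁ is itself the last coefficient.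
        obtain rfl | he := Nat.eq_zero_or_pos e
        · exact hlast
        · simpa [modRouth] using hi 1 le_rfl (by omega)
      exact (key h1).2 ⟨fun i _ hie => hi (i + 1) (by omega) (by omega), hlast⟩

/-! ### Characteristic polynomials and polynomial dependence on the gain -/

theorem eval_map_eq_evenPart_add_oddPart {n : ℕ} {q : ℝ[X]} (hq : q.natDegree = n) (s : ℂ) :
    (q.map (algebraMap ℝ ℂ)).eval s =
      evenPart n (routhCoeff n q) s + oddPart n (routhCoeff n q) s := by
  rw [evenPart_add_oddPart, ← Finset.sum_range_reflect, eval_map, eval₂_eq_sum_range, hq]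
  refine Finset.sum_congr rfl fun j hj => ?_
  have hj' : j ≤ n := Nat.lt_succ_iff.1 (Finset.mem_range.1 hj)
  rw [show n + 1 - 1 - j = n - j by omega, show n - (n - j) = j by omega, routhCoeff,
    if_pos (by omega), show n - (n - j) = j by omega]
  rfl

theorem isHurwitz_iff_isStableSeq {n : ℕ} (M : Matrix (Fin n) (Fin n) ℝ) :
    IsHurwitz M ↔ IsStableSeq n (routhCoeff n M.charpoly) := by
  have hdeg : M.charpoly.natDegree = n := by simp
  have hmap : (M.map (fun x : ℝ => (x : ℂ))).charpoly = M.charpoly.map (algebraMap ℝ ℂ) :=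
    Matrix.charpoly_map M (algebraMap ℝ ℂ)
  simp only [IsHurwitz, IsStableSeq, Matrix.mem_spectrum_iff_isRoot_charpoly, IsRoot.def, hmap,
    eval_map_eq_evenPart_add_oddPart hdeg]
  refine forall_congr' fun s => ?_
  rw [← not_lt, ← not_imp_not]

theorem isHurwitz_iff_routhTest_pos {n : ℕ} (M : Matrix (Fin n) (Fin n) ℝ) :
    IsHurwitz M ↔ ∀ i, 0 < routhTest n M.charpoly i := by
  have hlead : routhCoeff n M.charpoly 0 = 1 := by
    have h := M.charpoly_monic.coeff_natDegree
    rw [Matrix.charpoly_natDegree_eq_dim, Fintype.card_fin] at h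
    simpa [routhCoeff] using h
  rw [isHurwitz_iff_isStableSeq, isStableSeq_iff_modRouth_pos]
  · constructor
    · rintro ⟨hi, hlast⟩ i
      rw [routhTest]
      split_ifs with h
      · exact hlast
      · exact hi _ (by omega) (by omega)
    · intro h
      refine ⟨fun i h1 hi => ?_, ?_⟩
      · have := h ⟨i - 1, by omega⟩
        rw [routhTest, if_neg (by simp; omega)] at this
        simpa [Nat.sub_add_cancel h1] using this
      -- For n = 0 there are no tests, but c_n is the leading coefficient 1.
      · obtain rfl | hn := Nat.eq_zero_or_pos n
        · exact hlead ▸ one_pos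
        · have := h ⟨n - 1, by omega⟩
          rwa [routhTest, if_pos (by simp; omega)] at this
  · simp [hlead]
  · intro k hk
    simp [routhCoeff, hk]

section Map

variable {R S : Type*} [CommRing R] [CommRing S] (φ : R →+* S)

theorem map_routhCoeff (n : ℕ) (q : R[X]) (k : ℕ) :
    φ (routhCoeff n q k) = routhCoeff n (q.map φ) k := by
  unfold routhCoeff
  split_ifs <;> simp

theorem map_modRouth (c : ℕ → R) (i j : ℕ) :
    φ (modRouth c i j) = modRouth (fun k => φ (c k)) i j := by
  induction i using Nat.twoStepInduction generalizing j with
  | zero => rfl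
  | one => rfl
  | more i h0 h1 => simp only [modRouth, map_sub, map_mul, h0, h1]

theorem map_routhTest (n : ℕ) (q : R[X]) (i : Fin n) :
    φ (routhTest n q i) = routhTest n (q.map φ) i := by
  unfold routhTest
  split_ifs
  · exact map_routhCoeff φ n q n
  · rw [map_modRouth]
    simp only [map_routhCoeff]

end Map

/-- The closed-loop matrix `A(ρ) - B K` with indeterminate entries of `K` and `ρ`. -/
noncomputable def genericClosedLoop {n m p : ℕ} (A₀ : Matrix (Fin n) (Fin n) ℝ)
    (A : Fin p → Matrix (Fin n) (Fin n) ℝ) (B : Matrix (Fin n) (Fin m) ℝ) :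
    Matrix (Fin n) (Fin n) (MvPolynomial ((Fin m × Fin n) ⊕ Fin p) ℝ) :=
  Matrix.of fun a b =>
    MvPolynomial.C (A₀ a b) + ∑ l, MvPolynomial.X (Sum.inr l) * MvPolynomial.C (A l a b) -
      ∑ k, MvPolynomial.C (B a k) * MvPolynomial.X (Sum.inl (k, b))

theorem genericClosedLoop_map_eval {n m p : ℕ} (A₀ : Matrix (Fin n) (Fin n) ℝ)
    (A : Fin p → Matrix (Fin n) (Fin n) ℝ) (B : Matrix (Fin n) (Fin m) ℝ)
    (K : Matrix (Fin m) (Fin n) ℝ) (ρ : Fin p → ℝ) :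
    (genericClosedLoop A₀ A B).map
      (MvPolynomial.eval (Sum.elim (fun ij : Fin m × Fin n => K ij.1 ij.2) ρ)) =
      lpvMatrix A₀ A ρ - B * K := by
  ext a b
  simp [genericClosedLoop, lpvMatrix, Matrix.mul_apply, Matrix.sum_apply]

theorem mainTheorem10 {n m p : ℕ} (A₀ : Matrix (Fin n) (Fin n) ℝ)
    (A : Fin p → Matrix (Fin n) (Fin n) ℝ) (B : Matrix (Fin n) (Fin m) ℝ) :
    ∃ f : Fin n → MvPolynomial ((Fin m × Fin n) ⊕ Fin p) ℝ,
      (∀ (ρ : Fin p → ℝ) (K : Matrix (Fin m) (Fin n) ℝ) (i : Fin n),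
        evalGain K ρ (f i) = routhTest n (lpvMatrix A₀ A ρ - B * K).charpoly i) ∧
      ∀ ρ : Fin p → ℝ,
        stabilityRegion (lpvMatrix A₀ A ρ) B = {K | ∀ i : Fin n, 0 < evalGain K ρ (f i)} := by
  have hf : ∀ (ρ : Fin p → ℝ) (K : Matrix (Fin m) (Fin n) ℝ) (i : Fin n),
      evalGain K ρ (routhTest n (genericClosedLoop A₀ A B).charpoly i) =
        routhTest n (lpvMatrix A₀ A ρ - B * K).charpoly i := by
    intro ρ K i
    rw [evalGain, map_routhTest, ← Matrix.charpoly_map, genericClosedLoop_map_eval]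
  refine ⟨fun i => routhTest n (genericClosedLoop A₀ A B).charpoly i, hf, fun ρ => ?_⟩
  ext K
  simp only [stabilityRegion, Set.mem_ofPred_eq, hf]
  exact isHurwitz_iff_routhTest_pos _
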